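/- Let $p$ be a prime number, let $\overline{\mathbb{F}}_p$ be an algebraic closure of $\mathbb{F}_p$, and let $\mathbb{F}_{p^2}\subset\overline{\mathbb{F}}_p$ be the subfield with $p^2$ elements. Let $E$ be an elliptic curve over $\overline{\mathbb{F}}_p$, given by a (general) Weierstrass equation $y^2+a_1xy+a_3y=x^3+a_2x^2+a_4x+a_6$ with nonzero discriminant. Suppose that $E$ is supersingular, that is, $E[p]=\{P\in E(\overline{\mathbb{F}}_p) : pP=0\}=\{0\}$. Then $E$ is defined over $\mathbb{F}_{p^2}$: there is an elliptic curve $E_0$ over $\mathbb{F}_{p^2}$ whose base change to $\overline{\mathbb{F}}_p$ is isomorphic to $E$ over $\overline{\mathbb{F}}_p$. Moreover, $E$ is isomorphic over $\overline{\mathbb{F}}_p$ to the curve $E^{(p^2)}$ obtained by raising all the coefficients of the equation of $E$ to the power $p^2$. (Here isomorphisms respect the point at infinity, i.e. they are given by changes of variables $x = u^2x'+r$, $y=u^3y'+u^2sx'+t$ with $u\in\overline{\mathbb{F}}_p^{\times}$, $r,s,t\in\overline{\mathbb{F}}_p$.) -/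

import Mathlib

namespace EllipticDefs

open Classical in
/-- The `n`-torsion subgroup `E[n] = {P ∈ E(K) | n P = 0}` of the group of `K`-points of `E`
(the point at infinity being the neutral element). It is used with `K` algebraically closed,
where `E(K)` is the group of geometric points. -/
noncomputable def torsion {K : Type*} [Field K] (E : WeierstrassCurve K) (n : ℕ) :
    AddSubgroup E.toAffine.Point :=
  AddSubgroup.torsionBy E.toAffine.Point (n : ℤ)

/-- A curve over an algebraically closed field of characteristic `p` is supersingular if
`E[p] = {0}`. -/
def IsSupersingular {K : Type*} [Field K] (p : ℕ) (E : WeierstrassCurve K) : Prop :=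
  torsion E p = ⊥

/-- Two Weierstrass curves over `K` are isomorphic over `K` (as curves with a marked point):
they are related by a change of variables `(x, y) ↦ (u²x + r, u³y + u²sx + t)` with
`u ∈ Kˣ` and `r, s, t ∈ K`. -/
def Isomorphic {K : Type*} [Field K] (E E' : WeierstrassCurve K) : Prop :=
  ∃ C : WeierstrassCurve.VariableChange K, C • E = E'

/-- `E` over `K` is defined over `F ⊆ K`: it is isomorphic over `K` to the base change of an
elliptic curve over `F`. -/
def IsDefinedOver (F : Type*) {K : Type*} [Field F] [Field K] [Algebra F K]
    (E : WeierstrassCurve K) : Prop :=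
  ∃ E₀ : WeierstrassCurve F, E₀.IsElliptic ∧ Isomorphic E (E₀.map (algebraMap F K))

/-- The curve `E^{(q)}`, whose equation is obtained from that of `E` by raising all
coefficients to the power `q`. -/
def frobeniusTwist {K : Type*} [Field K] (q : ℕ) (E : WeierstrassCurve K) :
    WeierstrassCurve K :=
  ⟨E.a₁ ^ q, E.a₂ ^ q, E.a₃ ^ q, E.a₄ ^ q, E.a₆ ^ q⟩

end EllipticDefs

/-!
Isomorphism classes of elliptic curves over an algebraically closed field are classified by the
`j`-invariant, so both claims follow once `j(E) ^ p ^ 2 = j(E)` is known: this says that `j(E)` lies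
in the field with `p ^ 2` elements, where there is a curve with that `j`-invariant, and that `E` has
the same `j`-invariant as its twist by the `p ^ 2`-power Frobenius.

The equality is read off from multiplication by `p` on `x`-coordinates. For every `n` there are
coprime polynomials `A`, `B` with `A` monic of degree `n ^ 2` and `deg B < n ^ 2` such that
`x(n • P) = A(x(P)) / B(x(P))` (`WeierstrassCurve.exists_isMulByX`). They are constructed by
induction on `n`. The pair `{x(P + Q), x(P - Q)}` is a quadratic function without base points of the
pair `{x(P), x(Q)}` (`WeierstrassCurve.Affine.Point.exists_addSubMap_sym2x_eq`). For `n • P` and `P`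
one of the two values is `x((n - 1) • P)`, whose fraction is already known, and dividing it off gives
the fraction for `x((n + 1) • P)`; the degrees follow the parallelogram law
`(n + 1) ^ 2 + (n - 1) ^ 2 = 2 * n ^ 2 + 2`.

If `E` is supersingular, then for `n = p` the denominator has no zero, so it is a constant `b`, and
the numerator takes every value once because `P ↦ p • P` is injective. A monic polynomial of degree
`p ^ 2` over an algebraically closed field with this property is `X ^ p ^ 2 + k`, hence
`x(p • P) = (x(P) ^ p ^ 2 + k) / b`
(`WeierstrassCurve.exists_xRep_smul_eq_of_isSupersingular`). If `p` is odd, multiplication by `p`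
fixes the `2`-torsion points, so their `x`-coordinates satisfy `e ^ p ^ 2 = b * e - k`. The
`j`-invariant is a rational function of these three numbers that does not change under affine maps,
and therefore `j(E) ^ p ^ 2 = j(E)`. If `p = 2`, a supersingular curve has `a₁ = 0`, so `j(E) = 0`.
-/

section

open Polynomial

/-! ### Sums and differences of points on `x`-coordinates -/

namespace WeierstrassCurve.Affine.Point

variable {K : Type*} [Field K]

/-- The polynomial identity behind the formula for `x(P + Q) * x(P - Q)`: the two factors on the
right are `(x₁ - x₂) ^ 2 * x(P + Q)` and `(x₁ - x₂) ^ 2 * x(P - Q)`. -/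
lemma addX_mul_subX_identity {R : Type*} [CommRing R] {a₁ a₂ a₃ a₄ a₆ x₁ y₁ x₂ y₂ : R}
    (e₁ : y₁ ^ 2 + a₁ * x₁ * y₁ + a₃ * y₁ = x₁ ^ 3 + a₂ * x₁ ^ 2 + a₄ * x₁ + a₆)
    (e₂ : y₂ ^ 2 + a₁ * x₂ * y₂ + a₃ * y₂ = x₂ ^ 3 + a₂ * x₂ ^ 2 + a₄ * x₂ + a₆) :
    (x₁ - x₂) ^ 2 *
        ((x₁ * x₂) ^ 2 - (2 * a₄ + a₁ * a₃) * (x₁ * x₂) - (a₃ ^ 2 + 4 * a₆) * (x₁ + x₂) -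
          (a₁ ^ 2 * a₆ + 4 * a₂ * a₆ - a₁ * a₃ * a₄ + a₂ * a₃ ^ 2 - a₄ ^ 2)) =
      ((y₁ - y₂) ^ 2 + a₁ * (y₁ - y₂) * (x₁ - x₂) - (a₂ + x₁ + x₂) * (x₁ - x₂) ^ 2) *
        ((y₁ + y₂ + a₁ * x₂ + a₃) ^ 2 + a₁ * (y₁ + y₂ + a₁ * x₂ + a₃) * (x₁ - x₂) -
          (a₂ + x₁ + x₂) * (x₁ - x₂) ^ 2) := by
  obtain rfl : a₆ = y₁ ^ 2 + a₁ * x₁ * y₁ + a₃ * y₁ - (x₁ ^ 3 + a₂ * x₁ ^ 2 + a₄ * x₁) := by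
    linear_combination -e₁
  grind

variable [DecidableEq K] {W : WeierstrassCurve K}

lemma addSubMap_sym2x_of_X_ne {x₁ y₁ x₂ y₂ : K} (h₁ : W.toAffine.Nonsingular x₁ y₁)
    (h₂ : W.toAffine.Nonsingular x₂ y₂) (hx : x₁ ≠ x₂) (i : Fin 3) :
    (W.addSubMap i).eval ((some x₁ y₁ h₁).sym2x (some x₂ y₂ h₂)) = (x₁ - x₂) ^ 2 *
      (some x₁ y₁ h₁ + some x₂ y₂ h₂).sym2x (some x₁ y₁ h₁ - some x₂ y₂ h₂) i := by
  have e₁ := (W.toAffine.equation_iff x₁ y₁).mp h₁.1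
  have e₂ := (W.toAffine.equation_iff x₂ y₂).mp h₂.1
  have hd : x₁ - x₂ ≠ 0 := sub_ne_zero.mpr hx
  rw [sub_eq_add_neg (some x₁ y₁ h₁), neg_some, add_of_X_ne hx, add_of_X_ne hx, sym2x_some_some,
    sym2x_some_some, slope_of_X_ne hx, slope_of_X_ne hx]
  simp only [addX, negY, WeierstrassCurve.toAffine] at e₁ e₂ ⊢
  set l := (y₁ - y₂) / (x₁ - x₂) with hl
  set m := (y₁ - (-y₂ - W.a₁ * x₂ - W.a₃)) / (x₁ - x₂) with hm
  have hl : l * (x₁ - x₂) = y₁ - y₂ := div_mul_cancel₀ _ hd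
  have hm : m * (x₁ - x₂) = y₁ + y₂ + W.a₁ * x₂ + W.a₃ := by
    rw [hm, div_mul_cancel₀ _ hd]; ring
  clear_value l m
  have hadd : (x₁ - x₂) ^ 2 * (l ^ 2 + W.a₁ * l - W.a₂ - x₁ - x₂) =
      (y₁ - y₂) ^ 2 + W.a₁ * (y₁ - y₂) * (x₁ - x₂) - (W.a₂ + x₁ + x₂) * (x₁ - x₂) ^ 2 := by
    rw [← hl]; ring
  have hsub : (x₁ - x₂) ^ 2 * (m ^ 2 + W.a₁ * m - W.a₂ - x₁ - x₂) =
      (y₁ + y₂ + W.a₁ * x₂ + W.a₃) ^ 2 + W.a₁ * (y₁ + y₂ + W.a₁ * x₂ + W.a₃) * (x₁ - x₂) -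
        (W.a₂ + x₁ + x₂) * (x₁ - x₂) ^ 2 := by
    rw [← hm]; ring
  fin_cases i
  · simp [addSubMap, b₄, b₆, b₈]
    refine mul_left_cancel₀ (pow_ne_zero 2 hd) ?_
    rw [addX_mul_subX_identity e₁ e₂, ← hadd, ← hsub]
    ring
  · simp [addSubMap, b₂, b₄, b₆]
    linear_combination (-2) * e₁ - 2 * e₂ - hadd - hsub
  · simp [addSubMap]
    ring

/-- The duplication case of the formula for `x(P + Q)` and `x(P - Q)`, where `P - Q = 0`. -/
lemma addSubMap_sym2x_self {x y : K} (h : W.toAffine.Nonsingular x y)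
    (hy : y ≠ W.toAffine.negY x y) (i : Fin 3) :
    (W.addSubMap i).eval ((some x y h).sym2x (some x y h)) = (y - W.toAffine.negY x y) ^ 2 *
      (some x y h + some x y h).sym2x 0 i := by
  have e := (W.toAffine.equation_iff x y).mp h.1
  have hd := sub_ne_zero.mpr hy
  rw [add_self_of_Y_ne hy, sym2x_some_some, sym2x_some_zero, slope_of_Y_ne rfl hy]
  simp only [addX]
  set l := (3 * x ^ 2 + 2 * W.a₂ * x + W.a₄ - W.a₁ * y) / (y - W.toAffine.negY x y)
  have hl : l * (y - W.toAffine.negY x y) = 3 * x ^ 2 + 2 * W.a₂ * x + W.a₄ - W.a₁ * y :=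
    div_mul_cancel₀ _ hd
  clear_value l
  have hdbl : (y - W.toAffine.negY x y) ^ 2 * (l ^ 2 + W.a₁ * l - W.a₂ - x - x) =
      (3 * x ^ 2 + 2 * W.a₂ * x + W.a₄ - W.a₁ * y) ^ 2 +
      W.a₁ * (3 * x ^ 2 + 2 * W.a₂ * x + W.a₄ - W.a₁ * y) * (y - W.toAffine.negY x y)
      - (W.a₂ + x + x) * (y - W.toAffine.negY x y) ^ 2 := by
    rw [← hl]; ring
  fin_cases i
  · simp only [Fin.zero_eta, Matrix.cons_val_zero, hdbl]
    simp [addSubMap, b₄, b₆, b₈, negY]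
    linear_combination (W.a₁ ^ 2 + 4 * W.a₂ + 8 * x) * e
  · simp [addSubMap, b₂, b₄, b₆, negY]
    linear_combination (-4) * e
  · simp [addSubMap]
    ring

lemma exists_addSubMap_sym2x_self_eq [W.IsElliptic] (P : W.toAffine.Point) :
    ∃ c : K, c ≠ 0 ∧ ∀ i, (W.addSubMap i).eval (P.sym2x P) = c * (P + P).sym2x 0 i := by
  rcases P with _ | ⟨x, y, h⟩
  · refine ⟨1, one_ne_zero, fun i ↦ ?_⟩
    rw [← zero_def, add_zero, sym2x_zero_zero]
    fin_cases i <;> simp [addSubMap]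
  · by_cases hy : y = W.toAffine.negY x y
    · -- At a `2`-torsion point the last two forms vanish, so the first one does not.
      have e := (W.toAffine.equation_iff x y).mp h.1
      have h0 := W.addSubMap_ne_zero (sym2x_ne_zero (some x y h) (some x y h))
      have hP : some x y h + some x y h = 0 := add_self_of_Y_eq hy
      simp only [negY, WeierstrassCurve.toAffine] at e hy
      have h1 : (W.addSubMap 1).eval ((some x y h).sym2x (some x y h)) = 0 := by
        rw [sym2x_some_some]
        simp [addSubMap, b₂, b₄, b₆]
        linear_combination (-4) * e + (2 * y + W.a₁ * x + W.a₃) * hy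
      have h2 : (W.addSubMap 2).eval ((some x y h).sym2x (some x y h)) = 0 := by
        rw [sym2x_some_some]
        simp [addSubMap]
        ring
      rw [hP, sym2x_zero_zero]
      generalize (some x y h).sym2x (some x y h) = v at *
      refine ⟨(W.addSubMap 0).eval v, fun h3 ↦ h0 (funext fun i ↦ ?_), fun i ↦ ?_⟩
      · fin_cases i
        exacts [h3, h1, h2]
      · fin_cases i
        · simp
        · simpa using h1
        · simpa using h2
    · exact ⟨_, pow_ne_zero 2 (sub_ne_zero.mpr hy), addSubMap_sym2x_self h hy⟩

/-- The map `addSubMap` induces `{P, Q} ↦ {P + Q, P - Q}` on unordered pairs of `x`-coordinates. -/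
theorem exists_addSubMap_sym2x_eq [W.IsElliptic] (P Q : W.toAffine.Point) :
    ∃ c : K, c ≠ 0 ∧
      ∀ i, (W.addSubMap i).eval (P.sym2x Q) = c * (P + Q).sym2x (P - Q) i := by
  by_cases hPQ : P = Q
  · subst hPQ
    simpa using exists_addSubMap_sym2x_self_eq P
  by_cases hPQ' : P = -Q
  · subst hPQ'
    obtain ⟨c, hc, h⟩ := exists_addSubMap_sym2x_self_eq Q
    refine ⟨c, hc, fun i ↦ ?_⟩
    rw [sym2x_neg_left, h, neg_add_cancel, ← neg_add', sym2x_neg_right, sym2x_comm]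
  rcases P with _ | ⟨x₁, y₁, h₁⟩
  · rcases Q with _ | ⟨x₂, y₂, h₂⟩
    · exact absurd rfl hPQ
    · refine ⟨1, one_ne_zero, fun i ↦ ?_⟩
      rw [← zero_def, zero_add, zero_sub, sym2x_neg_right, sym2x_some_some, sym2x_zero_some]
      fin_cases i <;> simp [addSubMap] <;> ring
  · rcases Q with _ | ⟨x₂, y₂, h₂⟩
    · refine ⟨1, one_ne_zero, fun i ↦ ?_⟩
      rw [← zero_def, add_zero, sub_zero, sym2x_some_some, sym2x_some_zero]
      fin_cases i <;> simp [addSubMap] <;> ring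
    · have hx : x₁ ≠ x₂ := fun hx ↦ (X_eq_iff.mp hx).elim hPQ hPQ'
      exact ⟨_, pow_ne_zero 2 (sub_ne_zero.mpr hx), addSubMap_sym2x_of_X_ne h₁ h₂ hx⟩

end WeierstrassCurve.Affine.Point

/-! ### Multiplication by `n` on `x`-coordinates -/

/-- If `(a : b)` with `a`, `b` coprime is a zero of the binary quadratic form
`t₀ * Y ^ 2 - t₁ * X * Y + t₂ * X ^ 2`, then `a * Y - b * X` divides this form: it is the product of
`a * Y - b * X` and some `a' * Y - b' * X`. Neither `a` nor `b` has to be nonzero. -/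
lemma IsCoprime.exists_symm_mul_eq {R : Type*} [CommRing R] {a b t₀ t₁ t₂ : R}
    (hab : IsCoprime a b) (h : t₀ * b ^ 2 - t₁ * a * b + t₂ * a ^ 2 = 0) :
    ∃ a' b', a * a' = t₀ ∧ a * b' + b * a' = t₁ ∧ b * b' = t₂ := by
  obtain ⟨u, v, huv⟩ := hab
  -- The formulas come from `a' = (u * a + v * b) ^ 2 * a'` and likewise for `b'`.
  refine ⟨u ^ 2 * a * t₀ + 2 * u * v * b * t₀ + v ^ 2 * b * t₁ - v ^ 2 * a * t₂,
    v ^ 2 * b * t₂ + 2 * u * v * a * t₂ + u ^ 2 * a * t₁ - u ^ 2 * b * t₀, ?_, ?_, ?_⟩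
  · linear_combination (u * a + v * b + 1) * t₀ * huv - v ^ 2 * h
  · linear_combination (u * a + v * b + 1) * t₁ * huv + 2 * u * v * h
  · linear_combination (u * a + v * b + 1) * t₂ * huv - u ^ 2 * h

namespace WeierstrassCurve

open WeierstrassCurve.Affine WeierstrassCurve.Affine.Point

variable {K : Type*} [Field K] (W : WeierstrassCurve K)

lemma exists_nonsingular [IsAlgClosed K] [W.IsElliptic] (x : K) :
    ∃ y, W.toAffine.Nonsingular x y := by
  obtain ⟨y, hy⟩ := IsAlgClosed.exists_root
    (X ^ 2 + C (W.a₁ * x + W.a₃) * X + C (-(x ^ 3 + W.a₂ * x ^ 2 + W.a₄ * x + W.a₆)))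
    (by rw [← one_mul (X ^ 2), ← C_1, degree_quadratic one_ne_zero]; decide)
  refine ⟨y, equation_iff_nonsingular.mp <| (W.toAffine.equation_iff x y).mpr ?_⟩
  simp only [IsRoot, eval_add, eval_mul, eval_pow, eval_X, eval_C] at hy
  linear_combination hy

lemma natDegree_add_X_mul_le {A B : K[X]} {m : ℕ} (hA : A.natDegree ≤ m + 1)
    (hB : B.natDegree ≤ m) :
    (A + X * B).natDegree ≤ m + 1 :=
  natDegree_add_le_of_degree_le hA <|
    (natDegree_mul_le_of_le natDegree_X_le hB).trans_eq (add_comm 1 m)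

/-- The forms `addSubMap` evaluated at the symmetric product of `(A : B)` and `(X : 1)`. -/
noncomputable def addSubPoly (A B : K[X]) : Fin 3 → K[X] :=
  ![(A * X) ^ 2 - C W.b₄ * (A * X) * B - C W.b₆ * (A + X * B) * B - C W.b₈ * B ^ 2,
    2 * (A + X * B) * (A * X) + C W.b₂ * (A * X) * B + C W.b₄ * (A + X * B) * B + C W.b₆ * B ^ 2,
    (A + X * B) ^ 2 - 4 * (A * X) * B]

lemma monic_addSubPoly_zero {A B : K[X]} {m : ℕ} (hA : A.Monic)
    (hn : A.natDegree = m + 1) (hB : B.natDegree ≤ m) :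
    (addSubPoly W A B 0).Monic ∧ (addSubPoly W A B 0).natDegree = 2 * (m + 1) + 2 := by
  have hAX : ((A * X) ^ 2).Monic := (hA.mul monic_X).pow 2
  have hd : ((A * X) ^ 2).natDegree = 2 * (m + 1) + 2 := by
    rw [(hA.mul monic_X).natDegree_pow, hA.natDegree_mul monic_X, natDegree_X, hn]
    ring
  have hs : (A * X).natDegree ≤ m + 2 := natDegree_mul_le_of_le (m := m + 1) hn.le natDegree_X_le
  have ht := natDegree_add_X_mul_le hn.le hB
  set R := C W.b₄ * (A * X) * B + C W.b₆ * (A + X * B) * B + C W.b₈ * B ^ 2 with hR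
  have hlt : R.natDegree < ((A * X) ^ 2).natDegree := by
    rw [hd]
    refine Nat.lt_of_le_of_lt (m := 2 * m + 2) ?_ (by lia)
    refine natDegree_add_le_of_degree_le (natDegree_add_le_of_degree_le ?_ ?_) ?_
    · exact (natDegree_mul_le_of_le ((natDegree_C_mul_le _ _).trans hs) hB).trans (by lia)
    · exact (natDegree_mul_le_of_le ((natDegree_C_mul_le _ _).trans ht) hB).trans (by lia)
    · exact (natDegree_C_mul_le _ _).trans ((natDegree_pow_le_of_le 2 hB).trans (by lia))
  have hT : addSubPoly W A B 0 = (A * X) ^ 2 - R := by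
    simp only [addSubPoly, hR, Matrix.cons_val_zero]
    ring
  rw [hT]
  exact ⟨hAX.sub_of_left (degree_lt_degree hlt),
    (natDegree_sub_eq_left_of_natDegree_lt hlt).trans hd⟩

lemma natDegree_addSubPoly_one_le {A B : K[X]} {m : ℕ} (hn : A.natDegree = m + 1)
    (hB : B.natDegree ≤ m) :
    (addSubPoly W A B 1).natDegree ≤ 2 * (m + 1) + 1 := by
  have hs : (A * X).natDegree ≤ m + 2 := natDegree_mul_le_of_le (m := m + 1) hn.le natDegree_X_le
  have ht := natDegree_add_X_mul_le hn.le hB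
  change (2 * (A + X * B) * (A * X) + C W.b₂ * (A * X) * B + C W.b₄ * (A + X * B) * B +
    C W.b₆ * B ^ 2).natDegree ≤ _
  refine natDegree_add_le_of_degree_le (natDegree_add_le_of_degree_le
    (natDegree_add_le_of_degree_le ?_ ?_) ?_) ?_
  · rw [← C_ofNat]
    exact (natDegree_mul_le_of_le ((natDegree_C_mul_le _ _).trans ht) hs).trans (by lia)
  · exact (natDegree_mul_le_of_le ((natDegree_C_mul_le _ _).trans hs) hB).trans (by lia)
  · exact (natDegree_mul_le_of_le ((natDegree_C_mul_le _ _).trans ht) hB).trans (by lia)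
  · exact (natDegree_C_mul_le _ _).trans ((natDegree_pow_le_of_le 2 hB).trans (by lia))

variable [DecidableEq K]

/-- The fraction `A / B` is in lowest terms, has the degrees of numerator and denominator that are
expected of multiplication by `n`, and expresses `x(n • P)` in terms of `x(P)` for all affine points
`P` (with value `∞` where `n • P = 0`). -/
structure IsMulByX (n : ℕ) (A B : K[X]) : Prop where
  monic : A.Monic
  natDegree_eq : A.natDegree = n ^ 2
  degree_lt : B.degree < (n ^ 2 : ℕ)
  isCoprime : IsCoprime A B
  exists_xRep_eq : ∀ x y (h : W.toAffine.Nonsingular x y),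
    ∃ c : K, c ≠ 0 ∧ (n • some x y h).xRep = c • ![A.eval x, B.eval x]

lemma isMulByX_zero : W.IsMulByX 0 1 0 where
  monic := monic_one
  natDegree_eq := by simp
  degree_lt := by simp
  isCoprime := isCoprime_one_left
  exists_xRep_eq x y h := ⟨1, one_ne_zero, by simp⟩

lemma isMulByX_one : W.IsMulByX 1 X 1 where
  monic := monic_X
  natDegree_eq := by simp
  degree_lt := by simp
  isCoprime := isCoprime_one_right
  exists_xRep_eq x y h := ⟨1, one_ne_zero, by simp⟩

variable {W}

/-- If `A / B` gives the `x`-coordinate of `P` at `x = x(Q)`, then `addSubPoly` gives those of `P + Q`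
and `P - Q`. -/
lemma exists_addSubPoly_eval_eq [W.IsElliptic] {A B : K[X]} {x y : K}
    {h : W.toAffine.Nonsingular x y} {P : W.toAffine.Point}
    (hP : ∃ c : K, c ≠ 0 ∧ P.xRep = c • ![A.eval x, B.eval x]) :
    ∃ c : K, c ≠ 0 ∧ ∀ i,
      (W.addSubPoly A B i).eval x = c * (P + some x y h).sym2x (P - some x y h) i := by
  obtain ⟨c, hc, hP⟩ := hP
  obtain ⟨d, hd, hT⟩ := exists_addSubMap_sym2x_eq P (some x y h)
  refine ⟨d / c ^ 2, div_ne_zero hd (pow_ne_zero 2 hc), fun i ↦ ?_⟩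
  rw [div_mul_eq_mul_div, ← hT, eq_div_iff (pow_ne_zero 2 hc)]
  have hs : P.sym2x (some x y h) =
      ![c * (A.eval x * x), c * (A.eval x + x * B.eval x), c * B.eval x] := by
    simp only [sym2x, hP, xRep_some]
    ext j
    fin_cases j <;> simp <;> ring
  rw [hs]
  fin_cases i <;> simp [addSubPoly, addSubMap] <;> ring

variable [IsAlgClosed K] [W.IsElliptic]

/-- The induction step: `addSubPoly` of the fraction for `n + 1` describes the pair
`{x((n + 2) • P), x(n • P)}`, and the known fraction for `n` divides off. -/
lemma IsMulByX.exists_add_two {n : ℕ} {A₀ B₀ A₁ B₁ : K[X]} (h₀ : W.IsMulByX n A₀ B₀)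
    (h₁ : W.IsMulByX (n + 1) A₁ B₁) : ∃ A B, W.IsMulByX (n + 2) A B := by
  -- At each point the forms are the symmetric product of `x((n + 2) • P)` and `x(n • P)`.
  have key : ∀ x y (h : W.toAffine.Nonsingular x y), ∃ c : K, c ≠ 0 ∧
      (W.addSubPoly A₁ B₁ 0).eval x =
        c * (((n + 2) • some x y h).xRep 0 * A₀.eval x) ∧
      (W.addSubPoly A₁ B₁ 1).eval x =
        c * (((n + 2) • some x y h).xRep 0 * B₀.eval x +
          ((n + 2) • some x y h).xRep 1 * A₀.eval x) ∧
      (W.addSubPoly A₁ B₁ 2).eval x =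
        c * (((n + 2) • some x y h).xRep 1 * B₀.eval x) := by
    intro x y h
    obtain ⟨c, hc, hT⟩ := exists_addSubPoly_eval_eq (h := h) (h₁.exists_xRep_eq x y h)
    obtain ⟨d, hd, hx⟩ := h₀.exists_xRep_eq x y h
    rw [← succ_nsmul, succ_nsmul _ n, add_sub_cancel_right] at hT
    simp only [sym2x, hx] at hT
    refine ⟨c * d, mul_ne_zero hc hd, ?_, ?_, ?_⟩
    · rw [hT 0]; simp; ring
    · rw [hT 1]; simp; ring
    · rw [hT 2]; simp; ring
  obtain ⟨A, B, hA, hAB, hB⟩ := h₀.isCoprime.exists_symm_mul_eq (t₀ := W.addSubPoly A₁ B₁ 0)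
    (t₁ := W.addSubPoly A₁ B₁ 1) (t₂ := W.addSubPoly A₁ B₁ 2) <| by
      refine Polynomial.funext fun x ↦ ?_
      obtain ⟨y, h⟩ := exists_nonsingular W x
      obtain ⟨c, -, e₀, e₁, e₂⟩ := key x y h
      simp only [eval_add, eval_sub, eval_mul, eval_pow, e₀, e₁, e₂, eval_zero]
      ring
  obtain ⟨m, hm⟩ : ∃ m, (n + 1) ^ 2 = m + 1 := ⟨n ^ 2 + 2 * n, by ring⟩
  have hB₁ : B₁.natDegree ≤ m :=
    natDegree_le_iff_coeff_eq_zero.mpr fun N hN ↦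
      (degree_lt_iff_coeff_zero _ _).mp h₁.degree_lt N (by lia)
  obtain ⟨hmon, hdeg⟩ := monic_addSubPoly_zero W h₁.monic (h₁.natDegree_eq.trans hm) hB₁
  have hlt : (W.addSubPoly A₁ B₁ 1).degree < (2 * (n + 1) ^ 2 + 2 : ℕ) :=
    degree_le_natDegree.trans_lt <| Nat.cast_lt.mpr <| hm ▸ Nat.lt_succ_of_le
      (natDegree_addSubPoly_one_le W (h₁.natDegree_eq.trans hm) hB₁)
  rw [← hm] at hdeg
  have hAm : A.Monic := h₀.monic.of_mul_monic_left (hA ▸ hmon)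
  have hAd : A.natDegree = (n + 2) ^ 2 := by
    have := congrArg natDegree hA
    rw [h₀.monic.natDegree_mul hAm, hdeg, h₀.natDegree_eq] at this
    nlinarith
  have hx : ∀ x y (h : W.toAffine.Nonsingular x y),
      ∃ c : K, c ≠ 0 ∧ ((n + 2) • some x y h).xRep = c • ![A.eval x, B.eval x] := by
    intro x y h
    obtain ⟨c, hc, e₀, e₁, e₂⟩ := key x y h
    rw [← hA, eval_mul] at e₀
    rw [← hAB, eval_add, eval_mul, eval_mul] at e₁
    rw [← hB, eval_mul] at e₂
    generalize ((n + 2) • some x y h).xRep = v at *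
    -- The point `(A₀ : B₀)` is well defined, so the symmetric product determines the other factor.
    have hne : A₀.eval x ≠ 0 ∨ B₀.eval x ≠ 0 := by
      simpa using (isCoprime_iff_aeval_ne_zero_of_isAlgClosed K K A₀ B₀).mp h₀.isCoprime x
    have : A.eval x = c * v 0 ∧ B.eval x = c * v 1 := by
      rcases hne with hne | hne
      · have h0 : A.eval x = c * v 0 := mul_left_cancel₀ hne (by linear_combination e₀)
        rw [h0] at e₁
        exact ⟨h0, mul_left_cancel₀ hne (by linear_combination e₁)⟩
      · have h1 : B.eval x = c * v 1 := mul_left_cancel₀ hne (by linear_combination e₂)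
        rw [h1] at e₁
        exact ⟨mul_left_cancel₀ hne (by linear_combination e₁), h1⟩
    refine ⟨c⁻¹, inv_ne_zero hc, ?_⟩
    rw [this.1, this.2]
    ext i
    fin_cases i <;> simp [hc]
  refine ⟨A, B, hAm, hAd, ?_, ?_, hx⟩
  · -- The middle form bounds the degree of `B`. The last form, `B₀ * B`, does not: the degree of `B₀`
    -- may be much smaller than `n ^ 2` in positive characteristic.
    have hlt' : (A₀ * B).degree < (2 * (n + 1) ^ 2 + 2 : ℕ) := by
      rw [eq_sub_of_add_eq hAB]
      refine (degree_sub_le _ _).trans_lt (max_lt hlt ?_)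
      rw [hAm.degree_mul, degree_eq_natDegree hAm.ne_zero, hAd]
      calc B₀.degree + ((n + 2) ^ 2 : ℕ) < (n ^ 2 : ℕ) + ((n + 2) ^ 2 : ℕ) :=
            WithBot.add_lt_add_right (WithBot.coe_ne_bot) h₀.degree_lt
        _ = _ := by norm_cast; ring
    rw [mul_comm, h₀.monic.degree_mul, degree_eq_natDegree h₀.monic.ne_zero,
      h₀.natDegree_eq] at hlt'
    refine lt_of_add_lt_add_right (a := ((n ^ 2 : ℕ) : WithBot ℕ)) (hlt'.trans_eq ?_)
    norm_cast; ring
  · -- A common zero would give a point of `ℙ¹` with both coordinates zero.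
    refine (isCoprime_iff_aeval_ne_zero_of_isAlgClosed K K A B).mpr fun x ↦ ?_
    obtain ⟨y, h⟩ := exists_nonsingular W x
    obtain ⟨c, -, hc⟩ := hx x y h
    by_contra! h0
    simp only [coe_aeval_eq_eval] at h0
    refine xRep_ne_zero _ (hc.trans ?_)
    simp [h0.1, h0.2]

theorem exists_isMulByX (W : WeierstrassCurve K) [W.IsElliptic] (n : ℕ) :
    ∃ A B, W.IsMulByX n A B := by
  suffices h : (∃ A B, W.IsMulByX n A B) ∧ ∃ A B, W.IsMulByX (n + 1) A B from h.1
  induction n with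
  | zero => exact ⟨⟨_, _, W.isMulByX_zero⟩, _, _, W.isMulByX_one⟩
  | succ n ih =>
    obtain ⟨⟨_, _, h₀⟩, _, _, h₁⟩ := ih
    exact ⟨⟨_, _, h₁⟩, h₀.exists_add_two h₁⟩

end WeierstrassCurve

/-! ### Multiplication by `p` on a supersingular curve -/

/-- A monic polynomial over an algebraically closed field that takes every value only once is
a power of `X` up to a constant: subtract the value at `0`, then `0` is the only root. -/
lemma Polynomial.Monic.eq_X_pow_add_C_of_injective {K : Type*} [Field K] [IsAlgClosed K]
    {f : K[X]} (hf : f.Monic) (h0 : f.natDegree ≠ 0) (hinj : Function.Injective fun x ↦ f.eval x) :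
    f = X ^ f.natDegree + C (f.eval 0) := by
  have hlt : (C (f.eval 0)).degree < f.degree :=
    degree_lt_degree (by simpa using Nat.pos_of_ne_zero h0)
  have hg : (f - C (f.eval 0)).Monic := hf.sub_of_left hlt
  have hd : (f - C (f.eval 0)).natDegree = f.natDegree := natDegree_sub_C
  have hs := IsAlgClosed.splits (f - C (f.eval 0))
  have hr : (f - C (f.eval 0)).roots = Multiset.replicate f.natDegree 0 := by
    refine Multiset.eq_replicate.mpr ⟨hs.natDegree_eq_card_roots.symm.trans hd, fun r hr ↦ ?_⟩
    have := (mem_roots hg.ne_zero).mp hr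
    exact hinj (by simpa [sub_eq_zero] using this)
  have := hs.eq_prod_roots_of_monic hg
  rw [hr] at this
  rw [← sub_eq_iff_eq_add, this]
  simp

namespace WeierstrassCurve

open WeierstrassCurve.Affine WeierstrassCurve.Affine.Point EllipticDefs

variable {K : Type*} [Field K] {p : ℕ} {W : WeierstrassCurve K}

lemma smul_ne_zero_of_isSupersingular [DecidableEq K] (hW : IsSupersingular p W)
    {P : W.toAffine.Point} (hP : P ≠ 0) : p • P ≠ 0 := by
  obtain rfl : ‹DecidableEq K› = fun a b ↦ Classical.propDecidable (a = b) :=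
    Subsingleton.elim _ _
  classical
  intro h
  have hmem : P ∈ torsion W p := (natCast_zsmul P p).trans h
  rw [hW] at hmem
  exact hP hmem

/-- On a supersingular curve, multiplication by `p` is given on `x`-coordinates by
`x ↦ (x ^ p ^ 2 + k) / b`. -/
theorem exists_xRep_smul_eq_of_isSupersingular [DecidableEq K] [IsAlgClosed K] [W.IsElliptic]
    (hp : p ≠ 0) (hW : IsSupersingular p W) :
    ∃ b k : K, b ≠ 0 ∧ ∀ x y (h : W.toAffine.Nonsingular x y),
      ∃ c : K, c ≠ 0 ∧ (p • some x y h).xRep = c • ![x ^ p ^ 2 + k, b] := by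
  obtain ⟨A, B, hAB⟩ := exists_isMulByX W p
  -- A zero of the denominator would be the `x`-coordinate of a point of order `p`.
  have hB : ∀ x, B.eval x ≠ 0 := by
    intro x hx
    obtain ⟨y, h⟩ := exists_nonsingular W x
    obtain ⟨c, hc, hP⟩ := hAB.exists_xRep_eq x y h
    have h0 := smul_ne_zero_of_isSupersingular hW (some_ne_zero h)
    rcases hQ : p • some x y h with _ | ⟨x', y', h'⟩
    · exact h0 hQ
    · rw [hQ, xRep_some] at hP
      simpa [hx] using congrFun hP 1
  obtain ⟨b, rfl⟩ : ∃ b, B = C b := by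
    refine ⟨_, eq_C_of_degree_eq_zero (by_contra fun hd ↦ ?_)⟩
    obtain ⟨x, hx⟩ := IsAlgClosed.exists_root B hd
    exact hB x hx
  simp only [eval_C] at hB
  have hinj : Function.Injective fun x ↦ A.eval x := by
    intro x₁ x₂ hx
    obtain ⟨y₁, h₁⟩ := exists_nonsingular W x₁
    obtain ⟨y₂, h₂⟩ := exists_nonsingular W x₂
    obtain ⟨c₁, hc₁, e₁⟩ := hAB.exists_xRep_eq x₁ y₁ h₁
    obtain ⟨c₂, hc₂, e₂⟩ := hAB.exists_xRep_eq x₂ y₂ h₂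
    -- Both `p • P₁` and `p • P₂` are affine with the same denominator `b`, so the scaling of their
    -- coordinate vectors is the same.
    have normal : ∀ {Q : W.toAffine.Point} {c a : K}, Q ≠ 0 → Q.xRep = c • ![a, b] → c = b⁻¹ := by
      rintro (_ | ⟨x, y, h⟩) c a hQ e
      · exact absurd rfl hQ
      · rw [xRep_some] at e
        exact eq_inv_of_mul_eq_one_left (by simpa using (congrFun e 1).symm)
    simp only [eval_C] at e₁ e₂ hx
    obtain rfl := normal (smul_ne_zero_of_isSupersingular hW (some_ne_zero h₁)) e₁
    obtain rfl := normal (smul_ne_zero_of_isSupersingular hW (some_ne_zero h₂)) e₂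
    rw [hx, ← e₂] at e₁
    have hz : ∀ P : W.toAffine.Point, p • P = 0 → P = 0 := fun P h ↦
      by_contra fun hP ↦ smul_ne_zero_of_isSupersingular hW hP h
    refine (X_eq_iff (h₁ := h₁) (h₂ := h₂)).mpr
      ((eq_or_eq_neg_of_xRep_eq_xRep e₁).imp (fun e ↦ ?_) fun e ↦ ?_)
    · exact sub_eq_zero.mp (hz _ (by rw [smul_sub, e, sub_self]))
    · exact eq_neg_of_add_eq_zero_left (hz _ (by rw [smul_add, e, neg_add_cancel]))
  have hA := hAB.monic.eq_X_pow_add_C_of_injective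
    (hAB.natDegree_eq ▸ pow_ne_zero 2 hp) hinj
  rw [hAB.natDegree_eq] at hA
  refine ⟨b, A.eval 0, hB 0, fun x y h ↦ ?_⟩
  obtain ⟨c, hc, e⟩ := hAB.exists_xRep_eq x y h
  refine ⟨c, hc, e.trans ?_⟩
  rw [hA]
  simp [hp]

/-! ### The `j`-invariant of a supersingular curve -/

/-- For odd `p`, multiplication by `p` fixes the `2`-torsion points, so that `x ↦ x ^ p ^ 2` agrees
with an affine map on their `x`-coordinates. -/
lemma exists_pow_eq_of_isRoot_twoTorsionPolynomial [IsAlgClosed K] [W.IsElliptic]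
    (hp : Odd p) (hW : IsSupersingular p W) :
    ∃ b k : K, b ≠ 0 ∧ ∀ e : K, W.twoTorsionPolynomial.toPoly.IsRoot e →
      e ^ p ^ 2 = b * e + k := by
  classical
  obtain ⟨b, k, hb, H⟩ := exists_xRep_smul_eq_of_isSupersingular hp.pos.ne' hW
  refine ⟨b, -k, hb, fun e he ↦ ?_⟩
  obtain ⟨y, h⟩ := exists_nonsingular W e
  have hy : y = W.toAffine.negY e y := by
    have he' := (W.toAffine.equation_iff e y).mp h.1
    simp only [twoTorsionPolynomial, Cubic.toPoly, IsRoot, eval_add, eval_mul, eval_C, eval_pow,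
      eval_X, b₂, b₄, b₆] at he
    simp only [negY, WeierstrassCurve.toAffine] at he' ⊢
    refine eq_of_sub_eq_zero (pow_eq_zero_iff two_ne_zero |>.mp ?_)
    linear_combination he + 4 * he'
  have h2 : (2 : ℕ) • some e y h = 0 := by rw [two_nsmul, add_self_of_Y_eq hy]
  obtain ⟨c, hc, hP⟩ := H e y h
  obtain ⟨m, rfl⟩ := hp
  rw [add_nsmul, mul_nsmul, h2, smul_zero, zero_add, one_nsmul, xRep_some] at hP
  have h0 : e = c * (e ^ (2 * m + 1) ^ 2 + k) := by simpa using congrFun hP 0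
  have h1 : 1 = c * b := by simpa using congrFun hP 1
  refine mul_left_cancel₀ hc ?_
  linear_combination -h0 + e * h1

/-- An affine map with linear part `b` multiplies `c₄` by `b ^ 2` and `Δ` by `b ^ 6`, when these are
written in terms of the `x`-coordinates of the `2`-torsion points, so it preserves `j`. -/
theorem j_pow_eq_of_odd [Fact p.Prime] [CharP K p] [IsAlgClosed K] [W.IsElliptic] (hp : Odd p)
    (hW : IsSupersingular p W) : W.j ^ p ^ 2 = W.j := by
  obtain ⟨b, k, hb, H⟩ := exists_pow_eq_of_isRoot_twoTorsionPolynomial hp hW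
  have h2 : (2 : K) ≠ 0 := by
    refine Ring.two_ne_zero (fun h ↦ ?_)
    rw [ringChar.eq K p] at h
    exact absurd hp (by simp [h])
  have h4 : W.twoTorsionPolynomial.a ≠ 0 := by
    rw [twoTorsionPolynomial, show (4 : K) = 2 ^ 2 by norm_num]
    exact pow_ne_zero 2 h2
  obtain ⟨x, y, z, hroots⟩ := (Cubic.splits_iff_roots_eq_three (φ := RingHom.id K) h4).mp
    (IsAlgClosed.splits _)
  have hb' := Cubic.b_eq_three_roots h4 hroots
  have hc' := Cubic.c_eq_three_roots h4 hroots
  have hd' := Cubic.discr_eq_prod_three_roots h4 hroots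
  have hr : ∀ e ∈ ({x, y, z} : Multiset K), e ^ p ^ 2 = b * e + k := by
    intro e he
    rw [← hroots, Cubic.roots, Cubic.map_toPoly, Polynomial.map_id] at he
    exact H e (isRoot_of_mem_roots he)
  rw [twoTorsionPolynomial_discr] at hd'
  simp only [twoTorsionPolynomial, RingHom.id_apply] at hb' hc' hd'
  set φ := iterateFrobenius K p 2
  have hx : φ x = b * x + k := hr x (by simp)
  have hy : φ y = b * y + k := hr y (by simp)
  have hz : φ z = b * z + k := hr z (by simp)
  have hc4 : W.c₄ = 16 * ((x + y + z) ^ 2 - 3 * (x * y + x * z + y * z)) := by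
    rw [c₄, hb']
    linear_combination (-12) * hc'
  have hΔ : W.Δ = 16 * ((x - y) * (x - z) * (y - z)) ^ 2 := by
    refine mul_left_cancel₀ (pow_ne_zero 4 h2) ?_
    linear_combination hd'
  have hφc : φ W.c₄ = b ^ 2 * W.c₄ := by
    rw [hc4]
    simp only [map_mul, map_sub, map_add, map_pow, map_ofNat, hx, hy, hz]
    ring
  have hφΔ : φ W.Δ = b ^ 6 * W.Δ := by
    rw [hΔ]
    simp only [map_mul, map_sub, map_pow, map_ofNat, hx, hy, hz]
    ring
  have hj : W.j * W.Δ = W.c₄ ^ 3 := by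
    rw [j, ← coe_Δ']
    rw [mul_right_comm, Units.inv_mul, one_mul]
  have hj' := congrArg φ hj
  rw [map_mul, map_pow, hφc, hφΔ] at hj'
  change φ W.j = W.j
  refine mul_right_cancel₀ (mul_ne_zero (pow_ne_zero 6 hb) W.isUnit_Δ.ne_zero) ?_
  rw [hj']
  linear_combination (-b ^ 6) * hj

/-- In characteristic `2` a curve with `a₁ ≠ 0` has the point of order `2` with
`x`-coordinate `-a₃ / a₁`. -/
lemma j_eq_zero_of_isSupersingular_two [CharP K 2] [IsAlgClosed K] [W.IsElliptic]
    (hW : IsSupersingular 2 W) : W.j = 0 := by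
  classical
  refine W.j_eq_zero_of_char_two (by_contra fun ha ↦ ?_)
  obtain ⟨y, h⟩ := exists_nonsingular W (-W.a₃ / W.a₁)
  refine smul_ne_zero_of_isSupersingular hW (some_ne_zero h) ?_
  rw [two_nsmul, add_self_of_Y_eq]
  have h2 : (2 : K) = 0 := CharTwo.two_eq_zero
  rw [negY, mul_div_cancel₀ _ ha]
  linear_combination y * h2

theorem j_pow_eq_of_isSupersingular [Fact p.Prime] [CharP K p] [IsAlgClosed K] [W.IsElliptic]
    (hW : IsSupersingular p W) : W.j ^ p ^ 2 = W.j := by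
  rcases (Fact.out : p.Prime).eq_two_or_odd' with rfl | hp
  · rw [j_eq_zero_of_isSupersingular_two hW]
    simp
  · exact j_pow_eq_of_odd hp hW

end WeierstrassCurve

/-! ### Descent to the field with `p ^ 2` elements -/

lemma mem_range_algebraMap_of_pow_card_eq {F K : Type*} [Field F] [Field K] [Algebra F K] [Finite F]
    {x : K} (hx : x ^ Nat.card F = x) : x ∈ Set.range (algebraMap F K) := by
  have := Fintype.ofFinite F
  rw [Nat.card_eq_fintype_card] at hx
  have hcard := Fintype.one_lt_card (α := F)
  have hs : (X ^ Fintype.card F - X : F[X]).Splits := by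
    rw [splits_iff_card_roots, FiniteField.roots_X_pow_card_sub_X,
      FiniteField.X_pow_card_sub_X_natDegree_eq F hcard]
    rfl
  refine hs.mem_range_of_isRoot (FiniteField.X_pow_card_sub_X_ne_zero F hcard) ?_
  simp [hx]

end

theorem mainTheorem8 {p : ℕ} [Fact p.Prime]
    {K : Type*} [Field K] [Algebra (ZMod p) K] [IsAlgClosure (ZMod p) K]
    {F : Type*} [Field F] [Algebra F K] (hF : Nat.card F = p ^ 2)
    (E : WeierstrassCurve K) [E.IsElliptic] (hE : EllipticDefs.IsSupersingular p E) :
    EllipticDefs.IsDefinedOver F E ∧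
      EllipticDefs.Isomorphic E (EllipticDefs.frobeniusTwist (p ^ 2) E) := by
  have : IsAlgClosed K := IsAlgClosure.isAlgClosed (ZMod p)
  have : CharP K p := charP_of_injective_algebraMap (algebraMap (ZMod p) K).injective p
  have : Finite F := Nat.finite_of_card_ne_zero (hF ▸ pow_ne_zero 2 (Fact.out : p.Prime).ne_zero)
  have hj := WeierstrassCurve.j_pow_eq_of_isSupersingular hE
  constructor
  · classical
    obtain ⟨j₀, hj₀⟩ := mem_range_algebraMap_of_pow_card_eq (F := F) (hF ▸ hj)
    refine ⟨.ofJ j₀, inferInstance, WeierstrassCurve.exists_variableChange_of_j_eq _ _ ?_⟩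
    rw [WeierstrassCurve.map_j, WeierstrassCurve.ofJ_j, hj₀]
  · have htw : EllipticDefs.frobeniusTwist (p ^ 2) E = E.map (iterateFrobenius K p 2) := rfl
    rw [htw]
    refine WeierstrassCurve.exists_variableChange_of_j_eq _ _ ?_
    rw [WeierstrassCurve.map_j]
    exact hj.symm
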